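/- Let $\Omega$ be a compact metric space, $\sigma:\Omega\to\Omega$ a continuous map, and let $\mathscr P(\Omega,\sigma)$ be the set of $\sigma$-invariant Borel probability measures. Let $f:\Omega\to\mathbb R$ be a regular coboundary, i.e. $f=u\circ\sigma-u$ for some continuous $u:\Omega\to\mathbb R$. Call $f$ balanced if such a continuous $u$ can be chosen with $\int u\,d\mu$ independent of $\mu\in\mathscr P(\Omega,\sigma)$. For $0<\epsilon<1$ put $U_\epsilon[f](\omega)=-\sum_{k\ge 0}(1-\epsilon)^k f(\sigma^k(\omega))$. (1) If $f$ is balanced, then there exists a unique continuous $u:\Omega\to\mathbb R$ such that $f=u\circ\sigma-u$ and $\int u\,d\mu=0$ for all $\mu\in\mathscr P(\Omega,\sigma)$; moreover $U_\epsilon[f]\to u$ uniformly on $\Omega$ as $\epsilon\to0^+$. (2) If $(\Omega,\sigma)$ is minimal (the only closed sets $K$ with $\sigma(K)\subseteq K$ are $\emptyset$ and $\Omega$) and $f$ is not balanced, then there exist a continuous $u:\Omega\to\mathbb R$ with $f=u\circ\sigma-u$, two ergodic measures $\mu_0,\mu_1\in\mathscr P(\Omega,\sigma)$ with $\int u\,d\mu_0\neq\int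 u\,d\mu_1$, and a residual set $M\subseteq\Omega$ such that for every $\omega\in M$ there is a strictly decreasing sequence $(\epsilon_n)_{n\ge0}$ in $(0,1)$ converging to $0$ with $$U_{\epsilon_{2p}}[f](\omega)\to u(\omega)-\int u\,d\mu_0,\qquad U_{\epsilon_{2p+1}}[f](\omega)\to u(\omega)-\int u\,d\mu_1\qquad(p\to\infty).$$ -/

import Mathlib

open MeasureTheory Filter Topology

noncomputable section

namespace DiscountedCohomology

/-- `f = u ∘ σ - u`: the continuous function `u` is a transfer function of `f`. -/
def IsTransferFunction {Ω : Type*} [TopologicalSpace Ω] (σ : C(Ω, Ω)) (f u : C(Ω, ℝ)) : Prop :=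
  ∀ ω, f ω = u (σ ω) - u ω

/-- `μ` is a `σ`-invariant probability measure. -/
structure IsInvariantProb {Ω : Type*} [TopologicalSpace Ω] [MeasurableSpace Ω]
    (σ : C(Ω, Ω)) (μ : Measure Ω) : Prop where
  isProb : IsProbabilityMeasure μ
  invariant : MeasurePreserving σ μ μ

/-- `μ` is an ergodic `σ`-invariant probability measure. -/
structure IsErgodicProb {Ω : Type*} [TopologicalSpace Ω] [MeasurableSpace Ω]
    (σ : C(Ω, Ω)) (μ : Measure Ω) : Prop where
  isProb : IsProbabilityMeasure μ
  ergodic : Ergodic σ μ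

/-- `f` is a regular coboundary: it has a continuous transfer function. -/
def IsRegularCoboundary {Ω : Type*} [TopologicalSpace Ω] (σ : C(Ω, Ω)) (f : C(Ω, ℝ)) : Prop :=
  ∃ u : C(Ω, ℝ), IsTransferFunction σ f u

/-- `f` is a balanced coboundary: it has a continuous transfer function whose integral is the same
for all invariant probability measures. -/
def IsBalancedCoboundary {Ω : Type*} [TopologicalSpace Ω] [MeasurableSpace Ω]
    (σ : C(Ω, Ω)) (f : C(Ω, ℝ)) : Prop :=
  ∃ u : C(Ω, ℝ), IsTransferFunction σ f u ∧
    ∀ μ ν : Measure Ω, IsInvariantProb σ μ → IsInvariantProb σ ν →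
      ∫ ω, u ω ∂μ = ∫ ω, u ω ∂ν

/-- The system `(Ω, σ)` is minimal: the only closed forward-invariant sets are `∅` and `Ω`. -/
def IsMinimalSystem {Ω : Type*} [TopologicalSpace Ω] (σ : C(Ω, Ω)) : Prop :=
  ∀ K : Set Ω, IsClosed K → Set.MapsTo σ K K → K = ∅ ∨ K = Set.univ

/-- The discounted transfer function `U_ε[f] = - ∑ₖ (1 - ε)ᵏ f ∘ σᵏ`, used for `0 < ε < 1`. -/
def discountedTransfer {Ω : Type*} [TopologicalSpace Ω] (σ : C(Ω, Ω)) (f : C(Ω, ℝ))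
    (ε : ℝ) (ω : Ω) : ℝ :=
  -∑' k : ℕ, (1 - ε) ^ k * f (σ^[k] ω)

/-- The series defining the discounted transfer function converges. -/
theorem summable_discountedTransfer {Ω : Type*} [TopologicalSpace Ω] [CompactSpace Ω]
    (σ : C(Ω, Ω)) (f : C(Ω, ℝ)) {ε : ℝ} (h0 : 0 < ε) (h1 : ε < 1) (ω : Ω) :
    Summable fun k : ℕ => (1 - ε) ^ k * f (σ^[k] ω) := by
  have hg : Summable fun k : ℕ => (1 - ε) ^ k * ‖f‖ :=
    (summable_geometric_of_lt_one (by linarith) (by linarith)).mul_right _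
  refine Summable.of_norm_bounded hg fun k => ?_
  have hp : 0 ≤ (1 - ε) ^ k := pow_nonneg (by linarith) k
  rw [norm_mul, Real.norm_of_nonneg hp]
  exact mul_le_mul_of_nonneg_left (f.norm_coe_le_norm _) hp

end DiscountedCohomology

end

noncomputable section

namespace DiscountedCohomology

/-! Write `A_ε g` for the discounted mean. Summation by parts turns `f = u ∘ σ - u` into `U_ε[f] = u
- A_ε (u ∘ σ)`, so everything reduces to the behaviour of `A_ε` as `ε → 0⁺`. At each point `A_ε` is
integration against a probability measure that is invariant up to `O(ε)`, hence weak limits are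
invariant. Therefore a strict upper bound on all invariant integrals of `g` eventually bounds `A_ε
g` uniformly (`eventually_forall_discountedMean_lt`). If all the integrals vanish, `A_ε g → 0`
uniformly, which gives part (1).

For part (2), let `μ` maximize `∫ g`, with value `c`. Since `A_ε g` has `μ`-mean `c` and is
eventually below `c + δ`, it cannot stay below `c - η` on a set of fixed positive measure.
Minimality gives every nonempty open set positive measure, and Baire's theorem then makes `c` an
accumulation value at generic points. Ergodic maximizers for `u` and `-u` provide the two limits. -/

/-- The discounted mean `ε ∑ₖ (1 - ε)ᵏ g ∘ σᵏ`. -/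
def discountedMean {Ω : Type*} [TopologicalSpace Ω] (σ : C(Ω, Ω)) (g : C(Ω, ℝ))
    (ε : ℝ) (ω : Ω) : ℝ :=
  ε * ∑' k : ℕ, (1 - ε) ^ k * g (σ^[k] ω)

theorem discountedMean_neg {Ω : Type*} [TopologicalSpace Ω] (σ : C(Ω, Ω)) (g : C(Ω, ℝ)) (ε : ℝ)
    (ω : Ω) : discountedMean σ (-g) ε ω = -discountedMean σ g ε ω := by
  simp [discountedMean, tsum_neg]

/-! ### Algebra and bounds for discounted means -/

section Compact

variable {Ω : Type*} [TopologicalSpace Ω] [CompactSpace Ω] (σ : C(Ω, Ω))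

theorem tsum_discounted_eq_add (g : C(Ω, ℝ)) {ε : ℝ} (h0 : 0 < ε) (h1 : ε < 1) (ω : Ω) :
    ∑' k : ℕ, (1 - ε) ^ k * g (σ^[k] ω) =
      g ω + (1 - ε) * ∑' k : ℕ, (1 - ε) ^ k * (g.comp σ) (σ^[k] ω) := by
  rw [(summable_discountedTransfer σ g h0 h1 ω).tsum_eq_zero_add, ← tsum_mul_left]
  simp only [pow_zero, Function.iterate_zero, id_eq, one_mul, pow_succ', mul_assoc,
    Function.iterate_succ_apply', ContinuousMap.comp_apply]

theorem discountedTransfer_eq_sub_discountedMean {f u : C(Ω, ℝ)} (hu : IsTransferFunction σ f u)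
    {ε : ℝ} (h0 : 0 < ε) (h1 : ε < 1) (ω : Ω) :
    discountedTransfer σ f ε ω = u ω - discountedMean σ (u.comp σ) ε ω := by
  have h : ∑' k : ℕ, (1 - ε) ^ k * f (σ^[k] ω) =
      ∑' k : ℕ, (1 - ε) ^ k * (u.comp σ) (σ^[k] ω) - ∑' k : ℕ, (1 - ε) ^ k * u (σ^[k] ω) := by
    rw [← (summable_discountedTransfer σ _ h0 h1 ω).tsum_sub
      (summable_discountedTransfer σ u h0 h1 ω)]
    exact tsum_congr fun k => by rw [hu, ContinuousMap.comp_apply]; ring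
  rw [discountedTransfer, discountedMean, h, tsum_discounted_eq_add σ u h0 h1]
  ring

theorem discountedMean_eq_add (g : C(Ω, ℝ)) {ε : ℝ} (h0 : 0 < ε) (h1 : ε < 1) (ω : Ω) :
    discountedMean σ g ε ω = ε * g ω + (1 - ε) * discountedMean σ (g.comp σ) ε ω := by
  rw [discountedMean, discountedMean, tsum_discounted_eq_add σ g h0 h1]
  ring

theorem abs_discountedMean_le (g : C(Ω, ℝ)) {ε : ℝ} (h0 : 0 < ε) (h1 : ε < 1) (ω : Ω) :
    |discountedMean σ g ε ω| ≤ ‖g‖ := by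
  have hg : HasSum (fun k : ℕ => (1 - ε) ^ k * ‖g‖) (ε⁻¹ * ‖g‖) := by
    simpa using (hasSum_geometric_of_lt_one (r := 1 - ε) (by linarith) (by linarith)).mul_right ‖g‖
  have hle : ‖∑' k : ℕ, (1 - ε) ^ k * g (σ^[k] ω)‖ ≤ ε⁻¹ * ‖g‖ := by
    refine tsum_of_norm_bounded hg fun k => ?_
    have hp : 0 ≤ (1 - ε) ^ k := pow_nonneg (by linarith) k
    rw [norm_mul, Real.norm_of_nonneg hp]
    exact mul_le_mul_of_nonneg_left (g.norm_coe_le_norm _) hp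
  rw [discountedMean, abs_mul, abs_of_pos h0]
  calc ε * |∑' k : ℕ, (1 - ε) ^ k * g (σ^[k] ω)| ≤ ε * (ε⁻¹ * ‖g‖) :=
        mul_le_mul_of_nonneg_left hle h0.le
    _ = ‖g‖ := by field_simp

theorem discountedMean_of_comp_eq {g : C(Ω, ℝ)} (hg : g.comp σ = g) {ε : ℝ} (h0 : 0 < ε)
    (h1 : ε < 1) (ω : Ω) : discountedMean σ g ε ω = g ω := by
  have h := discountedMean_eq_add σ g h0 h1 ω
  rw [hg] at h
  have : ε * (discountedMean σ g ε ω - g ω) = 0 := by linarith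
  rcases mul_eq_zero.1 this with h | h <;> linarith

/-- The recursion gives `A_ε (g ∘ σ) - A_ε g = ε (A_ε (g ∘ σ) - g)`; this is the asymptotic
invariance. -/
theorem abs_discountedMean_comp_sub_le (g : C(Ω, ℝ)) {ε : ℝ} (h0 : 0 < ε) (h1 : ε < 1) (ω : Ω) :
    |discountedMean σ (g.comp σ) ε ω - discountedMean σ g ε ω| ≤ 2 * ‖g‖ * ε := by
  have h := discountedMean_eq_add σ g h0 h1 ω
  have hn : ‖g.comp σ‖ ≤ ‖g‖ :=
    (ContinuousMap.norm_le _ (norm_nonneg _)).2 fun x => g.norm_coe_le_norm (σ x)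
  have ha := (abs_discountedMean_le σ (g.comp σ) h0 h1 ω).trans hn
  have hb : |g ω| ≤ ‖g‖ := g.norm_coe_le_norm ω
  have he : discountedMean σ (g.comp σ) ε ω - discountedMean σ g ε ω =
      ε * (discountedMean σ (g.comp σ) ε ω - g ω) := by linarith
  rw [he, abs_mul, abs_of_pos h0, mul_comm]
  refine mul_le_mul_of_nonneg_right ?_ h0.le
  linarith [abs_sub (discountedMean σ (g.comp σ) ε ω) (g ω)]

theorem continuous_discountedMean (g : C(Ω, ℝ)) {ε : ℝ} (h0 : 0 < ε) (h1 : ε < 1) :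
    Continuous (discountedMean σ g ε) := by
  have hs : Summable fun k : ℕ => (1 - ε) ^ k * ‖g‖ :=
    (summable_geometric_of_lt_one (by linarith) (by linarith)).mul_right _
  refine continuous_const.mul (continuous_tsum (fun k => ?_) hs fun k ω => ?_)
  · exact continuous_const.mul (g.continuous.comp (σ.continuous.iterate k))
  · have hp : 0 ≤ (1 - ε) ^ k := pow_nonneg (by linarith) k
    rw [norm_mul, Real.norm_of_nonneg hp]
    exact mul_le_mul_of_nonneg_left (g.norm_coe_le_norm _) hp

end Compact

/-! ### Invariant measures tested on continuous functions -/

section Borel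

variable {Ω : Type*} [MetricSpace Ω] [MeasurableSpace Ω] [BorelSpace Ω]

theorem ext_of_forall_integral_continuousMap {μ ν : Measure Ω} [IsFiniteMeasure μ]
    [IsFiniteMeasure ν] (h : ∀ g : C(Ω, ℝ), ∫ x, g x ∂μ = ∫ x, g x ∂ν) : μ = ν :=
  ext_of_forall_integral_eq_of_IsFiniteMeasure fun g => h g.toContinuousMap

theorem integral_comp_of_measurePreserving (σ : C(Ω, Ω)) {μ : Measure Ω} (h : MeasurePreserving σ μ μ)
    (g : C(Ω, ℝ)) : ∫ x, (g.comp σ) x ∂μ = ∫ x, g x ∂μ := by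
  conv_rhs => rw [← h.map_eq]
  rw [integral_map σ.continuous.measurable.aemeasurable g.continuous.aestronglyMeasurable]
  rfl

theorem measure_pos_of_isMinimalSystem {σ : C(Ω, Ω)} (hσ : IsMinimalSystem σ) {μ : Measure Ω}
    (hμ : IsInvariantProb σ μ) {W : Set Ω} (hW : IsOpen W) (hne : W.Nonempty) : 0 < μ W := by
  have := hμ.isProb
  rw [pos_iff_ne_zero]
  intro h0
  have hpre (k : ℕ) : μ (σ^[k] ⁻¹' W) = 0 := by
    rw [(hμ.invariant.iterate k).measure_preimage hW.measurableSet.nullMeasurableSet, h0]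
  -- The points whose orbit never meets `W` form a closed forward-invariant set. If it is empty,
  -- null preimages of `W` cover the space.
  rcases hσ (⋂ k : ℕ, (σ^[k] ⁻¹' W)ᶜ)
    (isClosed_iInter fun k => (hW.preimage (σ.continuous.iterate k)).isClosed_compl)
    (fun x hx => by
      simp only [Set.mem_iInter, Set.mem_compl_iff, Set.mem_preimage] at hx ⊢
      exact fun k => by simpa using hx (k + 1)) with h | h
  · rw [← Set.compl_iUnion, Set.compl_empty_iff] at h
    have := measure_iUnion_null hpre
    rw [h, measure_univ] at this
    exact one_ne_zero this
  · obtain ⟨x, hx⟩ := hne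
    have hx' : x ∈ ⋂ k : ℕ, (σ^[k] ⁻¹' W)ᶜ := h ▸ Set.mem_univ x
    exact Set.mem_iInter.1 hx' 0 hx

theorem measurePreserving_iff_forall_integral (σ : C(Ω, Ω)) {μ : Measure Ω} [IsFiniteMeasure μ] :
    MeasurePreserving σ μ μ ↔ ∀ g : C(Ω, ℝ), ∫ x, (g.comp σ) x ∂μ = ∫ x, g x ∂μ := by
  refine ⟨integral_comp_of_measurePreserving σ, fun h => ⟨σ.continuous.measurable, ?_⟩⟩
  refine ext_of_forall_integral_continuousMap fun g => ?_
  rw [integral_map σ.continuous.measurable.aemeasurable g.continuous.aestronglyMeasurable]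
  exact h g

end Borel

/-! ### Weak limits, ergodic maximizers and generic points -/

section Measures

variable {Ω : Type*} [MetricSpace Ω] [CompactSpace Ω] [MeasurableSpace Ω] [BorelSpace Ω]
  (σ : C(Ω, Ω))

theorem _root_.ContinuousMap.integrable_of_isFiniteMeasure (g : C(Ω, ℝ)) (μ : Measure Ω)
    [IsFiniteMeasure μ] : Integrable g μ :=
  (BoundedContinuousFunction.mkOfCompact g).integrable μ

theorem continuous_integral_probabilityMeasure (g : C(Ω, ℝ)) :
    Continuous fun μ : ProbabilityMeasure Ω => ∫ x, g x ∂(μ : Measure Ω) :=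
  continuous_iff_continuousAt.2 fun _ =>
    ProbabilityMeasure.tendsto_iff_forall_integral_tendsto.1 tendsto_id
      (BoundedContinuousFunction.mkOfCompact g)

theorem exists_probabilityMeasure_integral_eq_discountedMean {ε : ℝ} (h0 : 0 < ε) (h1 : ε < 1)
    (ω : Ω) : ∃ m : ProbabilityMeasure Ω,
      ∀ g : C(Ω, ℝ), ∫ x, g x ∂(m : Measure Ω) = discountedMean σ g ε ω := by
  have hr : 0 ≤ 1 - ε := by linarith
  have hp (k : ℕ) : 0 ≤ ε * (1 - ε) ^ k := mul_nonneg h0.le (pow_nonneg hr k)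
  have hs : HasSum (fun k : ℕ => ε * (1 - ε) ^ k) 1 := by
    simpa [h0.ne'] using (hasSum_geometric_of_lt_one hr (by linarith)).mul_left ε
  set μ : Measure Ω :=
    Measure.sum fun k : ℕ => ENNReal.ofReal (ε * (1 - ε) ^ k) • Measure.dirac (σ^[k] ω)
  have hμ : IsProbabilityMeasure μ := ⟨by
    rw [Measure.sum_apply _ MeasurableSet.univ]
    simp only [Measure.smul_apply, measure_univ, smul_eq_mul, mul_one]
    rw [← ENNReal.ofReal_tsum_of_nonneg hp hs.summable, hs.tsum_eq, ENNReal.ofReal_one]⟩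
  refine ⟨⟨μ, hμ⟩, fun g => ?_⟩
  change ∫ x, g x ∂μ = _
  rw [integral_sum_measure (g.integrable_of_isFiniteMeasure μ), discountedMean, ← tsum_mul_left]
  refine tsum_congr fun k => ?_
  rw [integral_smul_measure, integral_dirac, ENNReal.toReal_ofReal (hp k), smul_eq_mul, mul_assoc]

theorem eventually_forall_discountedMean_lt {g : C(Ω, ℝ)} {c : ℝ}
    (h : ∀ μ : Measure Ω, IsInvariantProb σ μ → ∫ x, g x ∂μ < c) :
    ∀ᶠ ε in 𝓝[>] (0 : ℝ), ∀ ω, discountedMean σ g ε ω < c := by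
  -- The factor `⊤` encodes uniformity in `ω`. An ultrafilter of counterexamples has a weak limit
  -- measure by compactness.
  have hprod : ∀ᶠ p in 𝓝[>] (0 : ℝ) ×ˢ (⊤ : Filter Ω), discountedMean σ g p.1 p.2 < c := by
    by_contra hcon
    set l := 𝓝[>] (0 : ℝ) ×ˢ (⊤ : Filter Ω)
    have hne : (l ⊓ 𝓟 {p : ℝ × Ω | ¬ discountedMean σ g p.1 p.2 < c}).NeBot :=
      frequently_mem_iff_neBot.1 ((not_eventually.1 hcon).mono fun _ h => h)
    set F := Ultrafilter.of (l ⊓ 𝓟 {p : ℝ × Ω | ¬ discountedMean σ g p.1 p.2 < c})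
    have hFl : (F : Filter (ℝ × Ω)) ≤ l := (Ultrafilter.of_le _).trans inf_le_left
    have hFc : ∀ᶠ p in (F : Filter (ℝ × Ω)), ¬ discountedMean σ g p.1 p.2 < c :=
      (Ultrafilter.of_le _).trans inf_le_right (mem_principal_self _)
    have hfst : Tendsto Prod.fst (F : Filter (ℝ × Ω)) (𝓝[>] (0 : ℝ)) := tendsto_fst.mono_left hFl
    have hε : ∀ᶠ p in (F : Filter (ℝ × Ω)), 0 < p.1 ∧ p.1 < 1 :=
      hfst.eventually (Ioo_mem_nhdsGT one_pos)
    have hex : ∀ p : ℝ × Ω, ∃ m : ProbabilityMeasure Ω, 0 < p.1 ∧ p.1 < 1 →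
        ∀ g : C(Ω, ℝ), ∫ x, g x ∂(m : Measure Ω) = discountedMean σ g p.1 p.2 := by
      intro p
      by_cases hp : 0 < p.1 ∧ p.1 < 1
      · obtain ⟨m, hm⟩ := exists_probabilityMeasure_integral_eq_discountedMean σ hp.1 hp.2 p.2
        exact ⟨m, fun _ => hm⟩
      · exact ⟨⟨Measure.dirac p.2, inferInstance⟩, fun h => absurd h hp⟩
    choose m hm using hex
    obtain ⟨μ, -, hμ⟩ := isCompact_univ.ultrafilter_le_nhds (F.map m) (by simp)
    have hlim (g : C(Ω, ℝ)) : Tendsto (fun p : ℝ × Ω => discountedMean σ g p.1 p.2) F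
        (𝓝 (∫ x, g x ∂(μ : Measure Ω))) := by
      have := ((continuous_integral_probabilityMeasure g).tendsto μ).comp
        (show Tendsto m F (𝓝 μ) from hμ)
      exact this.congr' (hε.mono fun p hp => hm p hp g)
    have hinv : MeasurePreserving σ (μ : Measure Ω) μ := by
      refine (measurePreserving_iff_forall_integral σ).2 fun g => ?_
      rw [← sub_eq_zero]
      refine tendsto_nhds_unique ((hlim (g.comp σ)).sub (hlim g)) ?_
      have hz : Tendsto (fun p : ℝ × Ω => 2 * ‖g‖ * p.1) F (𝓝 0) := by
        simpa using (hfst.mono_right nhdsWithin_le_nhds).const_mul (2 * ‖g‖)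
      exact squeeze_zero_norm'
        (hε.mono fun p hp => abs_discountedMean_comp_sub_le σ g hp.1 hp.2 p.2) hz
    exact absurd (ge_of_tendsto (hlim g) (hFc.mono fun p hp => not_lt.1 hp))
      (not_le.2 (h μ ⟨inferInstance, hinv⟩))
  rw [← principal_univ, eventually_prod_principal_iff] at hprod
  simpa using hprod

theorem tendstoUniformly_discountedMean {g : C(Ω, ℝ)}
    (h : ∀ μ : Measure Ω, IsInvariantProb σ μ → ∫ x, g x ∂μ = 0) :
    TendstoUniformly (fun ε : ℝ => discountedMean σ g ε) 0 (𝓝[>] (0 : ℝ)) := by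
  rw [Metric.tendstoUniformly_iff]
  intro δ hδ
  have hneg : ∀ μ : Measure Ω, IsInvariantProb σ μ → ∫ x, (-g) x ∂μ < δ := fun μ hμ => by
    simp only [ContinuousMap.neg_apply, integral_neg, h μ hμ]; simpa using hδ
  filter_upwards [eventually_forall_discountedMean_lt σ (c := δ) fun μ hμ => by rwa [h μ hμ],
    eventually_forall_discountedMean_lt σ hneg] with ε h1 h2 ω
  have h2 := h2 ω
  rw [discountedMean_neg] at h2
  rw [dist_comm, Real.dist_eq, abs_lt]
  constructor <;> simp <;> linarith [h1 ω]

theorem eq_zero_of_comp_eq {w : C(Ω, ℝ)} (hw : w.comp σ = w)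
    (h : ∀ μ : Measure Ω, IsInvariantProb σ μ → ∫ x, w x ∂μ = 0) : w = 0 := by
  ext ω
  have hlim := (tendstoUniformly_discountedMean σ h).tendsto_at ω
  have hev : ∀ᶠ ε in 𝓝[>] (0 : ℝ), discountedMean σ w ε ω = w ω := by
    filter_upwards [Ioo_mem_nhdsGT (one_pos (α := ℝ))] with ε hε
    exact discountedMean_of_comp_eq σ hw hε.1 hε.2 ω
  exact tendsto_nhds_unique (tendsto_const_nhds.congr' (hev.mono fun _ h => h.symm)) hlim

/-- Krein–Milman: a continuous function has an ergodic maximizing measure. -/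
theorem exists_isErgodicProb_forall_integral_le (u : C(Ω, ℝ)) {ν : Measure Ω}
    (hν : IsInvariantProb σ ν) : ∃ μ : Measure Ω, IsErgodicProb σ μ ∧
      ∀ ρ : Measure Ω, IsInvariantProb σ ρ → ∫ x, u x ∂ρ ≤ ∫ x, u x ∂μ := by
  set I : Set (ProbabilityMeasure Ω) := {μ | MeasurePreserving σ (μ : Measure Ω) μ}
  have hI : IsCompact I := by
    refine IsClosed.isCompact ?_
    simp only [I, measurePreserving_iff_forall_integral, Set.ofPred_forall]
    exact isClosed_iInter fun g => isClosed_eq (continuous_integral_probabilityMeasure _)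
      (continuous_integral_probabilityMeasure _)
  have hνp := hν.isProb
  obtain ⟨μ₀, hμ₀, hmax⟩ := hI.exists_isMaxOn ⟨⟨ν, hνp⟩, hν.invariant⟩
    (continuous_integral_probabilityMeasure u).continuousOn
  set c := ∫ x, u x ∂(μ₀ : Measure Ω)
  have hle (ρ : Measure Ω) (hρ : IsProbabilityMeasure ρ) (hi : MeasurePreserving σ ρ ρ) :
      ∫ x, u x ∂ρ ≤ c := hmax (show (⟨ρ, hρ⟩ : ProbabilityMeasure Ω) ∈ I from hi)
  set K : Set (ProbabilityMeasure Ω) := I ∩ {μ | ∫ x, u x ∂(μ : Measure Ω) = c}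
  have hK : IsCompact K :=
    hI.inter_right (isClosed_eq (continuous_integral_probabilityMeasure u) continuous_const)
  -- Embeds measures in a locally convex space, where the compact image of the maximizing set `K`
  -- has an extreme point.
  set Φ : ProbabilityMeasure Ω → C(Ω, ℝ) → ℝ := fun μ g => ∫ x, g x ∂(μ : Measure Ω)
  have hΦ : Continuous Φ := continuous_pi continuous_integral_probabilityMeasure
  obtain ⟨_, ⟨⟨μ, ⟨hμI, hμc⟩, rfl⟩, hext⟩⟩ :=
    (hK.image hΦ).extremePoints_nonempty ⟨_, μ₀, ⟨hμ₀, rfl⟩, rfl⟩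
  refine ⟨μ, ⟨inferInstance, Ergodic.of_mem_extremePoints ?_⟩,
    fun ρ hρ => (hle ρ hρ.isProb hρ.invariant).trans_eq hμc.symm⟩
  rw [mem_extremePoints_iff_left]
  refine ⟨⟨hμI, inferInstance⟩, ?_⟩
  rintro ν₁ ⟨h₁, hp₁⟩ ν₂ ⟨h₂, hp₂⟩ ⟨a, b, ha, hb, hab, hμ⟩
  have hat : a ≠ ⊤ := fun h => by simp [h] at hab
  have hbt : b ≠ ⊤ := fun h => by simp [h] at hab
  have ha' : 0 < a.toReal := ENNReal.toReal_pos ha.ne' hat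
  have hb' : 0 < b.toReal := ENNReal.toReal_pos hb.ne' hbt
  have hab' : a.toReal + b.toReal = 1 := by
    rw [← ENNReal.toReal_add hat hbt, hab, ENNReal.toReal_one]
  have hint (g : C(Ω, ℝ)) : ∫ x, g x ∂(μ : Measure Ω) =
      a.toReal * ∫ x, g x ∂ν₁ + b.toReal * ∫ x, g x ∂ν₂ := by
    rw [← hμ, integral_add_measure ((g.integrable_of_isFiniteMeasure ν₁).smul_measure hat)
      ((g.integrable_of_isFiniteMeasure ν₂).smul_measure hbt), integral_smul_measure,
      integral_smul_measure, smul_eq_mul, smul_eq_mul]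
  have hle₁ := hle ν₁ hp₁ h₁
  have hle₂ := hle ν₂ hp₂ h₂
  have hu := hint u
  rw [show ∫ x, u x ∂(μ : Measure Ω) = c from hμc] at hu
  have hc : a.toReal * c + b.toReal * c = c := by rw [← add_mul, hab', one_mul]
  -- `K` is a face: both components of a maximizer must themselves be maximizers.
  have he₁ : ∫ x, u x ∂ν₁ = c := by
    refine le_antisymm hle₁ (le_of_mul_le_mul_left ?_ ha')
    linarith [mul_le_mul_of_nonneg_left hle₂ hb'.le]
  have he₂ : ∫ x, u x ∂ν₂ = c := by
    refine le_antisymm hle₂ (le_of_mul_le_mul_left ?_ hb')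
    linarith [mul_le_mul_of_nonneg_left hle₁ ha'.le]
  have hΦ₁ : Φ ⟨ν₁, hp₁⟩ = Φ μ :=
    hext ⟨⟨ν₁, hp₁⟩, ⟨h₁, he₁⟩, rfl⟩ ⟨⟨ν₂, hp₂⟩, ⟨h₂, he₂⟩, rfl⟩
      ⟨a.toReal, b.toReal, ha', hb', hab', funext fun g => (hint g).symm⟩
  exact ext_of_forall_integral_continuousMap fun g => congrFun hΦ₁ g

theorem integral_discountedMean {μ : Measure Ω} (hμ : IsInvariantProb σ μ) (g : C(Ω, ℝ)) {ε : ℝ}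
    (h0 : 0 < ε) (h1 : ε < 1) : ∫ ω, discountedMean σ g ε ω ∂μ = ∫ ω, g ω ∂μ := by
  have := hμ.isProb
  have hr : 0 ≤ 1 - ε := by linarith
  have hk (k : ℕ) : ∫ ω, (1 - ε) ^ k * g (σ^[k] ω) ∂μ = (1 - ε) ^ k * ∫ ω, g ω ∂μ := by
    rw [integral_const_mul, ← integral_comp_of_measurePreserving
      ⟨σ^[k], σ.continuous.iterate k⟩ (hμ.invariant.iterate k) g]
    rfl
  have hc (k : ℕ) : Continuous fun ω => (1 - ε) ^ k * g (σ^[k] ω) :=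
    continuous_const.mul (g.continuous.comp (σ.continuous.iterate k))
  have hb (k : ℕ) (ω : Ω) : ‖(1 - ε) ^ k * g (σ^[k] ω)‖ ≤ (1 - ε) ^ k * ‖g‖ := by
    rw [norm_mul, Real.norm_of_nonneg (pow_nonneg hr k)]
    exact mul_le_mul_of_nonneg_left (g.norm_coe_le_norm _) (pow_nonneg hr k)
  have hs : Summable fun k : ℕ => (1 - ε) ^ k * ‖g‖ :=
    (summable_geometric_of_lt_one hr (by linarith)).mul_right _
  have hsum := integral_tsum_of_summable_integral_norm (μ := μ)
    (F := fun (k : ℕ) ω => (1 - ε) ^ k * g (σ^[k] ω))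
    (fun k => (⟨_, hc k⟩ : C(Ω, ℝ)).integrable_of_isFiniteMeasure μ)
    (hs.of_nonneg_of_le (fun k => integral_nonneg fun _ => norm_nonneg _) fun k => by
      refine (integral_mono ((⟨_, (hc k).norm⟩ : C(Ω, ℝ)).integrable_of_isFiniteMeasure μ)
        (integrable_const _) (hb k)).trans_eq ?_
      simp)
  simp only [discountedMean]
  rw [integral_const_mul, ← hsum, tsum_congr hk, tsum_mul_right,
    tsum_geometric_of_lt_one hr (by linarith), sub_sub_cancel, ← mul_assoc,
    mul_inv_cancel₀ h0.ne', one_mul]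

/-- In a minimal system, the discounted means of `g` accumulate at the maximal integral of `g`
at generic points. -/
theorem residual_frequently_discountedMean (hσ : IsMinimalSystem σ) {g : C(Ω, ℝ)} {μ : Measure Ω}
    (hμ : IsInvariantProb σ μ)
    (hmax : ∀ ρ : Measure Ω, IsInvariantProb σ ρ → ∫ x, g x ∂ρ ≤ ∫ x, g x ∂μ) :
    ∀ᶠ ω in residual Ω, ∀ δ > 0, ∃ᶠ ε in 𝓝[>] (0 : ℝ),
      |discountedMean σ g ε ω - ∫ x, g x ∂μ| < δ := by
  have := hμ.isProb
  set c := ∫ x, g x ∂μ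
  have hup (δ : ℝ) (hδ : 0 < δ) := eventually_forall_discountedMean_lt σ (g := g) (c := c + δ)
    fun ρ hρ => (hmax ρ hρ).trans_lt (by linarith)
  -- The bound `1 / (n + 2)` forces `ε < 1` even for `n = 0`.
  let V (n : ℕ) : Set Ω := ⋃ ε ∈ Set.Ioo (0 : ℝ) (1 / (n + 2)),
    {ω | c - 1 / (n + 1) < discountedMean σ g ε ω}
  have hlt (n : ℕ) : (1 : ℝ) / (n + 2) < 1 := by
    rw [div_lt_one (by positivity)]; have : (0 : ℝ) ≤ n := n.cast_nonneg; linarith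
  have hVo (n : ℕ) : IsOpen (V n) := isOpen_biUnion fun ε hε =>
    isOpen_lt continuous_const (continuous_discountedMean σ g hε.1 (hε.2.trans (hlt n)))
  have hVd (n : ℕ) : Dense (V n) := by
    refine dense_iff_inter_open.2 fun W hW hne => ?_
    by_contra hemp
    have hpos : 0 < μ.real W :=
      ENNReal.toReal_pos (measure_pos_of_isMinimalSystem hσ hμ hW hne).ne' (measure_ne_top _ _)
    set η : ℝ := 1 / (n + 1)
    have hη : 0 < η := by positivity
    obtain ⟨ε, hlt', hε0, hε1⟩ := ((hup (η * μ.real W / 2) (by positivity)).and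
      (Ioo_mem_nhdsGT (show (0 : ℝ) < 1 / (n + 2) by positivity))).exists
    have hε1' := hε1.trans (hlt n)
    set A : C(Ω, ℝ) := ⟨discountedMean σ g ε, continuous_discountedMean σ g hε0 hε1'⟩
    have hA : ∫ x, A x ∂μ = c := integral_discountedMean σ hμ g hε0 hε1'
    have hWle : ∀ ω ∈ W, A ω ≤ c - η := fun ω hω => by
      by_contra hcon
      exact hemp ⟨ω, hω, Set.mem_biUnion ⟨hε0, hε1⟩ (not_le.1 hcon)⟩
    -- Integrating this gives `c ≤ c - η μ(W) / 2`, a contradiction.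
    have hb : ∀ ω, A ω ≤ c + η * μ.real W / 2 - W.indicator (fun _ => η) ω := fun ω => by
      by_cases hω : ω ∈ W
      · rw [Set.indicator_of_mem hω]
        have := hWle ω hω
        have : 0 < η * μ.real W := by positivity
        linarith
      · rw [Set.indicator_of_notMem hω, sub_zero]
        exact (hlt' ω).le
    have hind : Integrable (W.indicator fun _ => η) μ :=
      (integrable_const η).indicator hW.measurableSet
    have := integral_mono (A.integrable_of_isFiniteMeasure μ) ((integrable_const _).sub hind) hb
    rw [hA] at this
    simp only [Pi.sub_apply] at this
    rw [integral_sub (integrable_const _) hind,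
      integral_indicator_const _ hW.measurableSet, integral_const] at this
    simp at this
    nlinarith [mul_pos hη hpos]
  have hres : ∀ᶠ ω in residual Ω, ∀ n, ω ∈ V n :=
    eventually_countable_forall.2 fun n => residual_of_dense_open (hVo n) (hVd n)
  filter_upwards [hres] with ω hω δ hδ
  rw [frequently_iff]
  intro U hU
  obtain ⟨r, hr, hrU⟩ := mem_nhdsGT_iff_exists_Ioo_subset.1 (inter_mem hU (hup δ hδ))
  obtain ⟨n, hn⟩ := exists_nat_one_div_lt (lt_min hδ (Set.mem_Ioi.1 hr))
  obtain ⟨ε, hε, hεc⟩ := Set.mem_iUnion₂.1 (hω n)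
  have hn2 : (1 : ℝ) / (n + 2) < 1 / (n + 1) :=
    one_div_lt_one_div_of_lt (by positivity) (by linarith)
  have hεr : ε < r := hε.2.trans (hn2.trans (hn.trans_le (min_le_right _ _)))
  have hmem := hrU ⟨hε.1, hεr⟩
  refine ⟨ε, hmem.1, abs_lt.2 ⟨?_, ?_⟩⟩
  · have h1 := hn.trans_le (min_le_left _ _)
    have h2 : c - 1 / (n + 1) < discountedMean σ g ε ω := hεc
    linarith
  · have h3 := hmem.2 ω
    linarith

end Measures

/-- A function on `(0, ∞)` with two accumulation values at `0` approaches them alternately along a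
strictly decreasing sequence. -/
theorem exists_strictAnti_alternating {φ : ℝ → ℝ} {a b : ℝ}
    (ha : ∀ δ > 0, ∃ᶠ ε in 𝓝[>] (0 : ℝ), |φ ε - a| < δ)
    (hb : ∀ δ > 0, ∃ᶠ ε in 𝓝[>] (0 : ℝ), |φ ε - b| < δ) :
    ∃ ε : ℕ → ℝ, (∀ n, 0 < ε n ∧ ε n < 1) ∧ StrictAnti ε ∧ Tendsto ε atTop (𝓝 0) ∧
      Tendsto (fun p => φ (ε (2 * p))) atTop (𝓝 a) ∧
      Tendsto (fun p => φ (ε (2 * p + 1))) atTop (𝓝 b) := by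
  let c (n : ℕ) : ℝ := if Even n then a else b
  have hstep (n : ℕ) (r : ℝ) (hr : 0 < r) :
      ∃ e, 0 < e ∧ e < r ∧ e < 1 / (n + 1) ∧ |φ e - c n| < 1 / (n + 1) := by
    have hc : ∃ᶠ ε in 𝓝[>] (0 : ℝ), |φ ε - c n| < 1 / (n + 1) := by
      by_cases h : Even n
      · simpa [c, h] using ha (1 / (n + 1)) (by positivity)
      · simpa [c, h] using hb (1 / (n + 1)) (by positivity)
    obtain ⟨e, he, he0, her⟩ := (hc.and_eventually (Ioo_mem_nhdsGT
      (lt_min hr (show (0 : ℝ) < 1 / (n + 1) by positivity)))).exists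
    exact ⟨e, he0, her.trans_le (min_le_left _ _), her.trans_le (min_le_right _ _), he⟩
  choose! s hs0 hsr hsn hsφ using hstep
  -- Each term is the upper bound for the next; starting from `1` keeps all terms below `1`.
  let ε : ℕ → ℝ := fun n => Nat.rec (s 0 1) (fun k e => s (k + 1) e) n
  have hpos (n : ℕ) : 0 < ε n := by
    induction n with
    | zero => exact hs0 0 1 one_pos
    | succ k ih => exact hs0 (k + 1) (ε k) ih
  have hanti : StrictAnti ε := strictAnti_nat_of_succ_lt fun n => hsr (n + 1) (ε n) (hpos n)
  have hprop (n : ℕ) : ε n < 1 / (n + 1) ∧ |φ (ε n) - c n| < 1 / (n + 1) := by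
    cases n with
    | zero => exact ⟨hsn 0 1 one_pos, hsφ 0 1 one_pos⟩
    | succ k => exact ⟨hsn (k + 1) (ε k) (hpos k), hsφ (k + 1) (ε k) (hpos k)⟩
  have hlim : Tendsto (fun n => φ (ε n) - c n) atTop (𝓝 0) :=
    squeeze_zero_norm (fun n => (hprop n).2.le) tendsto_one_div_add_atTop_nhds_zero_nat
  refine ⟨ε, fun n => ⟨hpos n, ?_⟩, hanti,
    squeeze_zero (fun n => (hpos n).le) (fun n => (hprop n).1.le)
      tendsto_one_div_add_atTop_nhds_zero_nat, ?_, ?_⟩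
  · exact (hanti.antitone n.zero_le).trans_lt (hsr 0 1 one_pos)
  · have h2 : Tendsto (fun p : ℕ => 2 * p) atTop atTop :=
      tendsto_atTop_mono (fun p => by simp; omega) tendsto_id
    have := hlim.comp h2
    simpa [Function.comp_def, c, tendsto_sub_nhds_zero_iff] using this
  · have h2 : Tendsto (fun p : ℕ => 2 * p + 1) atTop atTop :=
      tendsto_atTop_mono (fun p => by simp; omega) tendsto_id
    have := hlim.comp h2
    simpa [Function.comp_def, c, tendsto_sub_nhds_zero_iff] using this

/-! ### The balanced and unbalanced cases -/

section Main

variable {Ω : Type*} [MetricSpace Ω] [CompactSpace Ω] [MeasurableSpace Ω] [BorelSpace Ω]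
  {σ : C(Ω, Ω)} {f : C(Ω, ℝ)}

theorem IsBalancedCoboundary.exists_unique_tendstoUniformly (hf : IsBalancedCoboundary σ f) :
    ∃ u : C(Ω, ℝ),
      (IsTransferFunction σ f u ∧ ∀ μ : Measure Ω, IsInvariantProb σ μ → ∫ ω, u ω ∂μ = 0) ∧
      (∀ v : C(Ω, ℝ), IsTransferFunction σ f v →
        (∀ μ : Measure Ω, IsInvariantProb σ μ → ∫ ω, v ω ∂μ = 0) → v = u) ∧
      TendstoUniformly (fun ε : ℝ => discountedTransfer σ f ε) u (𝓝[>] (0 : ℝ)) := by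
  obtain ⟨w, hw, hbal⟩ := hf
  obtain ⟨u, hu, hu0⟩ : ∃ u : C(Ω, ℝ), IsTransferFunction σ f u ∧
      ∀ μ : Measure Ω, IsInvariantProb σ μ → ∫ ω, u ω ∂μ = 0 := by
    by_cases hex : ∃ ν : Measure Ω, IsInvariantProb σ ν
    · obtain ⟨ν, hν⟩ := hex
      refine ⟨w - ContinuousMap.const Ω (∫ ω, w ω ∂ν), fun ω => ?_, fun μ hμ => ?_⟩
      · simp [hw ω]
      · have := hμ.isProb
        simp only [ContinuousMap.sub_apply, ContinuousMap.const_apply]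
        rw [integral_sub (w.integrable_of_isFiniteMeasure μ) (integrable_const _),
          hbal μ ν hμ hν]
        simp
    -- Covers empty `Ω`, where no measure is available to normalize `w`.
    · exact ⟨w, hw, fun μ hμ => absurd ⟨μ, hμ⟩ hex⟩
  refine ⟨u, ⟨hu, hu0⟩, fun v hv hv0 => ?_, ?_⟩
  · refine sub_eq_zero.1 (eq_zero_of_comp_eq σ (ContinuousMap.ext fun ω => ?_) fun μ hμ => ?_)
    · simp only [ContinuousMap.comp_apply, ContinuousMap.sub_apply]
      linarith [hu ω, hv ω]
    · have := hμ.isProb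
      simp only [ContinuousMap.sub_apply]
      rw [integral_sub (v.integrable_of_isFiniteMeasure μ) (u.integrable_of_isFiniteMeasure μ),
        hu0 μ hμ, hv0 μ hμ, sub_zero]
  · have hlim := tendstoUniformly_discountedMean σ (g := u.comp σ) fun μ hμ => by
      rw [integral_comp_of_measurePreserving σ hμ.invariant, hu0 μ hμ]
    rw [Metric.tendstoUniformly_iff] at hlim ⊢
    intro δ hδ
    filter_upwards [hlim δ hδ, Ioo_mem_nhdsGT (one_pos (α := ℝ))] with ε h hε ω
    rw [discountedTransfer_eq_sub_discountedMean σ hu hε.1 hε.2, Real.dist_eq]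
    simpa [Real.dist_eq] using h ω

theorem IsMinimalSystem.exists_alternating_limits (hσ : IsMinimalSystem σ)
    (hf : IsRegularCoboundary σ f) (hbal : ¬ IsBalancedCoboundary σ f) :
    ∃ (u : C(Ω, ℝ)) (μ₀ μ₁ : Measure Ω) (M : Set Ω),
      IsTransferFunction σ f u ∧ IsErgodicProb σ μ₀ ∧ IsErgodicProb σ μ₁ ∧
      ∫ ω, u ω ∂μ₀ ≠ ∫ ω, u ω ∂μ₁ ∧ M ∈ residual Ω ∧
      ∀ ω ∈ M, ∃ ε : ℕ → ℝ,
        (∀ n, 0 < ε n ∧ ε n < 1) ∧ StrictAnti ε ∧ Tendsto ε atTop (𝓝 0) ∧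
        Tendsto (fun p : ℕ => discountedTransfer σ f (ε (2 * p)) ω) atTop
          (𝓝 (u ω - ∫ x, u x ∂μ₀)) ∧
        Tendsto (fun p : ℕ => discountedTransfer σ f (ε (2 * p + 1)) ω) atTop
          (𝓝 (u ω - ∫ x, u x ∂μ₁)) := by
  obtain ⟨u, hu⟩ := hf
  obtain ⟨ν, ν', hν, hν', hne⟩ : ∃ ν ν' : Measure Ω, IsInvariantProb σ ν ∧ IsInvariantProb σ ν' ∧
      ∫ ω, u ω ∂ν ≠ ∫ ω, u ω ∂ν' := by
    by_contra! hcon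
    exact hbal ⟨u, hu, hcon⟩
  obtain ⟨μ₀, he₀, hm₀⟩ := exists_isErgodicProb_forall_integral_le σ u hν
  obtain ⟨μ₁, he₁, hm₁⟩ := exists_isErgodicProb_forall_integral_le σ (-u) hν
  have hi₀ : IsInvariantProb σ μ₀ := ⟨he₀.isProb, he₀.ergodic.toMeasurePreserving⟩
  have hi₁ : IsInvariantProb σ μ₁ := ⟨he₁.isProb, he₁.ergodic.toMeasurePreserving⟩
  have hcomp {ρ : Measure Ω} (hρ : IsInvariantProb σ ρ) :=
    integral_comp_of_measurePreserving σ hρ.invariant u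
  have hM₀ := residual_frequently_discountedMean σ hσ (g := u.comp σ) hi₀ fun ρ hρ => by
    rw [hcomp hρ, hcomp hi₀]; exact hm₀ ρ hρ
  have hM₁ := residual_frequently_discountedMean σ hσ (g := -(u.comp σ)) hi₁ fun ρ hρ => by
    simpa only [ContinuousMap.neg_apply, integral_neg, hcomp hρ, hcomp hi₁] using hm₁ ρ hρ
  simp only [ContinuousMap.neg_apply, integral_neg] at hm₁ hM₁
  refine ⟨u, μ₀, μ₁, _, hu, he₀, he₁, fun heq => hne ?_, inter_mem hM₀ hM₁, fun ω hω => ?_⟩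
  -- Equal maximal and minimal integrals would force `∫ u` to agree on `ν` and `ν'`.
  · linarith [hm₀ ν hν, hm₀ ν' hν', hm₁ ν hν, hm₁ ν' hν']
  · have hω₀ := hω.1
    have hω₁ := hω.2
    simp only [Set.mem_ofPred_eq, hcomp hi₀, hcomp hi₁, discountedMean_neg] at hω₀ hω₁
    obtain ⟨ε, hε, hanti, hε0, hlim₀, hlim₁⟩ := exists_strictAnti_alternating
      (φ := fun ε => discountedMean σ (u.comp σ) ε ω) hω₀
      (b := ∫ x, u x ∂μ₁) fun δ hδ => (hω₁ δ hδ).mono fun ε h => by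
        rw [← abs_neg]; convert h using 2; ring
    refine ⟨ε, hε, hanti, hε0, ?_, ?_⟩
    · simpa only [discountedTransfer_eq_sub_discountedMean σ hu (hε _).1 (hε _).2]
        using tendsto_const_nhds.sub hlim₀
    · simpa only [discountedTransfer_eq_sub_discountedMean σ hu (hε _).1 (hε _).2]
        using tendsto_const_nhds.sub hlim₁

end Main

end DiscountedCohomology

end

theorem theorem4 {Ω : Type*} [MetricSpace Ω] [CompactSpace Ω] [MeasurableSpace Ω] [BorelSpace Ω]
    (σ : C(Ω, Ω)) (f : C(Ω, ℝ)) (hf : DiscountedCohomology.IsRegularCoboundary σ f) :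
    (DiscountedCohomology.IsBalancedCoboundary σ f →
      ∃ u : C(Ω, ℝ),
        (DiscountedCohomology.IsTransferFunction σ f u ∧
          ∀ μ : Measure Ω, DiscountedCohomology.IsInvariantProb σ μ → ∫ ω, u ω ∂μ = 0) ∧
        (∀ v : C(Ω, ℝ), DiscountedCohomology.IsTransferFunction σ f v →
          (∀ μ : Measure Ω, DiscountedCohomology.IsInvariantProb σ μ → ∫ ω, v ω ∂μ = 0) →
          v = u) ∧
        TendstoUniformly (fun ε : ℝ => DiscountedCohomology.discountedTransfer σ f ε) u
          (𝓝[>] (0 : ℝ))) ∧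
    (DiscountedCohomology.IsMinimalSystem σ → ¬ DiscountedCohomology.IsBalancedCoboundary σ f →
      ∃ (u : C(Ω, ℝ)) (μ₀ μ₁ : Measure Ω) (M : Set Ω),
        DiscountedCohomology.IsTransferFunction σ f u ∧
        DiscountedCohomology.IsErgodicProb σ μ₀ ∧
        DiscountedCohomology.IsErgodicProb σ μ₁ ∧
        ∫ ω, u ω ∂μ₀ ≠ ∫ ω, u ω ∂μ₁ ∧
        M ∈ residual Ω ∧
        ∀ ω ∈ M, ∃ ε : ℕ → ℝ,
          (∀ n, 0 < ε n ∧ ε n < 1) ∧ StrictAnti ε ∧ Tendsto ε atTop (𝓝 0) ∧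
          Tendsto (fun p : ℕ => DiscountedCohomology.discountedTransfer σ f (ε (2 * p)) ω) atTop
            (𝓝 (u ω - ∫ x, u x ∂μ₀)) ∧
          Tendsto (fun p : ℕ => DiscountedCohomology.discountedTransfer σ f (ε (2 * p + 1)) ω) atTop
            (𝓝 (u ω - ∫ x, u x ∂μ₁))) := by
  exact ⟨DiscountedCohomology.IsBalancedCoboundary.exists_unique_tendstoUniformly,
    fun hσ hbal => hσ.exists_alternating_limits hf hbal⟩
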